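/- Let $n\ge 5$ and, for $j=1,\dots,n$, let $I_j=\{j,j+1,\dots,j+n-3\}$ with indices taken modulo $n$ in $\{1,\dots,n\}$ (so $|I_j|=n-2$). Let $u^1,\dots,u^n\in\mathbb R^n_+$ be entrywise nonnegative vectors such that the set of indices of positive entries of $u^j$ equals $I_j$ for every $j$. Let $\mathcal C^n$ be the cone of copositive matrices, i.e. real symmetric $n\times n$ matrices $A$ with $x^TAx\ge 0$ for all $x\in\mathbb R^n_+$, let $\mathcal S^k_+$ be the cone of real symmetric positive semi-definite $k\times k$ matrices, and set \[ F_{\bf u}=\{A\in\mathcal C^n : (u^j)^TAu^j=0,\ j=1,\dots,n\},\qquad P_{\bf u}=\{A\in\mathcal S^n_+ : (u^j)^TAu^j=0,\ j=1,\dots,n\}. \] Let $U$ be the $n\times n$ matrix with columns $u^1,\dots,u^n$. Then the following are equivalent: (i) $F_{\bf u}$ consists of positive semi-definite matrices of ranks up to $n-3$ inclusive, i.e. every matrix in $F_{\bf u}$ is positive semi-definite, and the set of ranks of matrices in $F_{\bf u}$ is exactly $\{0,1,\dots,n-3\}$; (ii) $U$ is the slack matrix of a polyhedral convex cone $K\subset\mathbb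 R^3$ with exactly $n$ extreme rays; (iii) $F_{\bf u}=P_{\bf u}$, and $F_{\bf u}$ is linearly isomorphic to $\mathcal S_+^{n-3}$, i.e. some linear isomorphism between the linear spans of these two cones maps one cone onto the other. Here a slack matrix of a polyhedral convex cone $K\subset\mathbb R^m$ with dual cone $K^*=\{f : \langle f,x\rangle\ge 0\ \forall x\in K\}$ in the space of linear functionals on $\mathbb R^m$ is any matrix $(\langle f_i,x_j\rangle)_{i=1,\dots,s;\,j=1,\dots,r}$, where $x_1,\dots,x_r$ are generators of the extreme rays of $K$ and $f_1,\dots,f_s$ are generators of the extreme rays of $K^*$, with exactly one generator for each extreme ray, listed in any order. -/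

import Mathlib

open scoped Matrix

noncomputable section

/-- The cyclic index set `I_j`, consisting of the `n - 2` cyclically consecutive indices
`j, j + 1, …, j + n - 3` (mod `n`), with indices counted from `0`. -/
def cyclicSupport (n : ℕ) (j : Fin n) : Set (Fin n) :=
  {i | ∃ k : ℕ, k < n - 2 ∧ (i : ℕ) = ((j : ℕ) + k) % n}

/-- The cone `C^n` of copositive real symmetric matrices. -/
def copositiveCone (n : ℕ) : Set (Matrix (Fin n) (Fin n) ℝ) :=
  {A | A.IsSymm ∧ ∀ x : Fin n → ℝ, (∀ i, 0 ≤ x i) → 0 ≤ x ⬝ᵥ (A *ᵥ x)}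

/-- The cone `S_+^n` of positive semi-definite real symmetric matrices. -/
def psdCone (n : ℕ) : Set (Matrix (Fin n) (Fin n) ℝ) :=
  {A | A.PosSemidef}

/-- The face `F_u` of the copositive cone defined by the vectors `u j`. -/
def copositiveFace {n : ℕ} (u : Fin n → Fin n → ℝ) : Set (Matrix (Fin n) (Fin n) ℝ) :=
  {A | A ∈ copositiveCone n ∧ ∀ j, u j ⬝ᵥ (A *ᵥ u j) = 0}

/-- The face `P_u` of the positive semi-definite cone defined by the vectors `u j`. -/
def psdFace {n : ℕ} (u : Fin n → Fin n → ℝ) : Set (Matrix (Fin n) (Fin n) ℝ) :=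
  {A | A ∈ psdCone n ∧ ∀ j, u j ⬝ᵥ (A *ᵥ u j) = 0}

/-- Two cones are linearly isomorphic if some linear isomorphism between their linear spans maps
one onto the other. -/
def LinearlyIsomorphicCones {V W : Type*} [AddCommGroup V] [Module ℝ V]
    [AddCommGroup W] [Module ℝ W] (C : Set V) (D : Set W) : Prop :=
  ∃ φ : Submodule.span ℝ C ≃ₗ[ℝ] Submodule.span ℝ D,
    ∀ x : Submodule.span ℝ C, (x : V) ∈ C ↔ (φ x : W) ∈ D

/-- A polyhedral convex cone: an intersection of finitely many closed linear half-spaces. -/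
def IsPolyhedralCone {E : Type*} [AddCommGroup E] [Module ℝ E] (K : PointedCone ℝ E) : Prop :=
  ∃ s : Finset (Module.Dual ℝ E), ∀ x : E, x ∈ K ↔ ∀ f ∈ s, 0 ≤ f x

/-- The dual cone `K^*`, in the space of linear functionals. -/
def dualCone {E : Type*} [AddCommGroup E] [Module ℝ E] (K : PointedCone ℝ E) :
    PointedCone ℝ (Module.Dual ℝ E) :=
  PointedCone.dual (Module.Dual.eval ℝ E) (K : Set E)

/-- The ray `{c • y | c ≥ 0}` generated by `y`. -/
def coneRay {E : Type*} [AddCommGroup E] [Module ℝ E] (y : E) : PointedCone ℝ E :=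
  PointedCone.hull ℝ {y}

/-- The extreme rays of a convex cone: its faces that are rays generated by a nonzero vector. -/
def extremeRays {E : Type*} [AddCommGroup E] [Module ℝ E] (K : PointedCone ℝ E) :
    Set (PointedCone ℝ E) :=
  {R | R.IsFaceOf K ∧ ∃ y : E, y ≠ 0 ∧ R = coneRay y}

/-- `M` is a slack matrix of `K`: its entries are `⟨f i, x j⟩`, where the `x j` generate the extreme
rays of `K` and the `f i` generate the extreme rays of `K^*`, with exactly one generator listed for
each extreme ray. -/
def IsSlackMatrix {E : Type*} [AddCommGroup E] [Module ℝ E] {s r : ℕ} (K : PointedCone ℝ E)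
    (M : Matrix (Fin s) (Fin r) ℝ) : Prop :=
  ∃ (x : Fin r → E) (f : Fin s → Module.Dual ℝ E),
    Set.BijOn (fun j => coneRay (x j)) Set.univ (extremeRays K) ∧
    Set.BijOn (fun i => coneRay (f i)) Set.univ (extremeRays (dualCone K)) ∧
    ∀ i j, M i j = f i (x j)

end

/-! All three conditions say that the span `L` of the vectors `u j` has dimension 3. The supports of
the first three vectors form a triangular pattern on the last three coordinates, so `dim L ≥ 3`
always.

A positive semi-definite form vanishing at each `u j` has `L` in its kernel, so it is a form on the
quotient by `L`. Hence `P_u` is a copy of the semi-definite cone of order `n - dim L`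
(`psdFace_eq_image`), and both its ranks and the dimension of its span determine `dim L`. A slack
matrix of a cone in dimension 3 factors through that space, so (ii) gives `dim L ≤ 3`.

Conversely, let `dim L = 3`. A matrix of `F_u` is compared with its pullback along the projection
that kills `L`; the pullback is positive semi-definite, and the difference vanishes by propagation
around the cycle (`eq_zero_of_mulVec_cyclicSupport`). For (ii), the coordinate functionals on `L`
and the vectors `u j` pair with a cyclic zero pattern, which is the facet-ray incidence of a
polygonal cone (`isSlackMatrix_of_cyclicPairing`). -/

/-! ### Cones in dimension three with the facet-ray incidence of a polygon. -/

section CyclicPairing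

variable {E : Type*} [AddCommGroup E] [Module ℝ E]

theorem mem_coneRay {x y : E} : y ∈ coneRay x ↔ ∃ c : ℝ, 0 ≤ c ∧ c • x = y := by
  unfold coneRay PointedCone.hull
  rw [Submodule.mem_span_singleton]
  constructor
  · rintro ⟨c, rfl⟩
    exact ⟨c, c.2, rfl⟩
  · rintro ⟨c, hc, rfl⟩
    exact ⟨⟨c, hc⟩, rfl⟩

/-- In dimension three, if `f i` vanishes on `x j` precisely for the two successors `j` of `i`,
then the kernel of `f i` is spanned by the corresponding two vectors. -/
theorem exists_eq_add_of_cyclicPairing {ι : Type*} (hE : Module.finrank ℝ E = 3)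
    (s : Equiv.Perm ι) (hs : ∀ i, s i ≠ i) (hss : ∀ i, s (s i) ≠ i)
    {f : ι → Module.Dual ℝ E} {x : ι → E}
    (hzero : ∀ i j, f i (x j) = 0 ↔ j = s i ∨ j = s (s i)) (i : ι) {y : E} (hy : f i y = 0) :
    ∃ a b : ℝ, y = a • x (s i) + b • x (s (s i)) := by
  have h1 : f i (x (s i)) = 0 := (hzero _ _).2 (Or.inl rfl)
  have h2 : f i (x (s (s i))) = 0 := (hzero _ _).2 (Or.inr rfl)
  have h3 : f i (x (s (s (s i)))) ≠ 0 := by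
    simp [hzero, hs, hss]
  have h4 : f (s i) (x (s (s i))) = 0 := (hzero _ _).2 (Or.inl rfl)
  have h5 : f (s i) (x (s i)) ≠ 0 := by
    rw [Ne, hzero]
    exact not_or.2 ⟨(hs _).symm, (hss _).symm⟩
  have h7 : f (s i) (x (s (s (s i)))) = 0 := (hzero _ _).2 (Or.inr rfl)
  have h6 : x (s (s i)) ≠ 0 := by
    intro h
    have : f (s (s i)) (x (s (s i))) ≠ 0 := by
      rw [Ne, hzero]
      exact not_or.2 ⟨(hs _).symm, (hss _).symm⟩
    simp [h] at this
  -- Among these three vectors `f i` is nonzero only on the third and `f (s i)` only on the first,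
  -- which isolates the coefficients.
  have hli : LinearIndependent ℝ ![x (s i), x (s (s i)), x (s (s (s i)))] := by
    rw [Fintype.linearIndependent_iff]
    intro g hg
    simp only [Fin.sum_univ_three, Matrix.cons_val] at hg
    have e1 := congrArg (f i) hg
    have e2 := congrArg (f (s i)) hg
    simp only [map_add, map_smul, smul_eq_mul, map_zero, h1, h2, mul_zero, zero_add] at e1
    simp only [map_add, map_smul, smul_eq_mul, map_zero, h4, h7, mul_zero, add_zero] at e2
    have g0 : g 0 = 0 := (mul_eq_zero.1 e2).resolve_right h5
    have g2 : g 2 = 0 := (mul_eq_zero.1 e1).resolve_right h3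
    rw [g0, g2, zero_smul, zero_smul, zero_add, add_zero] at hg
    have g1 : g 1 = 0 := (smul_eq_zero.1 hg).resolve_right h6
    intro k
    fin_cases k <;> assumption
  have : Module.Finite ℝ E := Module.finite_of_finrank_pos (by omega)
  have htop := hli.span_eq_top_of_card_eq_finrank' (by simp [hE])
  have hmem : y ∈ Submodule.span ℝ (Set.range ![x (s i), x (s (s i)), x (s (s (s i)))]) :=
    htop ▸ Submodule.mem_top
  obtain ⟨c, rfl⟩ := (Submodule.mem_span_range_iff_exists_fun ℝ).1 hmem
  simp only [Fin.sum_univ_three, Matrix.cons_val] at hy ⊢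
  simp only [map_add, map_smul, smul_eq_mul, h1, h2, mul_zero, zero_add] at hy
  rw [(mul_eq_zero.1 hy).resolve_right h3, zero_smul, add_zero]
  exact ⟨_, _, rfl⟩

/-- Subtracting from a point of `K` the largest multiple of some `x j` that keeps it in `K` makes
some `f i` vanish. The remainder lies in the plane of two consecutive generators, and the two
neighbouring functionals show its coefficients to be nonnegative. -/
theorem hull_eq_of_cyclicPairing {ι : Type*} [Finite ι] [Nonempty ι]
    (hE : Module.finrank ℝ E = 3)
    (s : Equiv.Perm ι) (hs : ∀ i, s i ≠ i) (hss : ∀ i, s (s i) ≠ i)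
    {f : ι → Module.Dual ℝ E} {x : ι → E}
    (hzero : ∀ i j, f i (x j) = 0 ↔ j = s i ∨ j = s (s i)) (hnonneg : ∀ i j, 0 ≤ f i (x j))
    {K : PointedCone ℝ E} (hK : ∀ y, y ∈ K ↔ ∀ i, 0 ≤ f i y) :
    K = PointedCone.hull ℝ (Set.range x) := by
  have hx : ∀ (c : ℝ) j, 0 ≤ c → c • x j ∈ PointedCone.hull ℝ (Set.range x) := fun c j hc =>
    Submodule.smul_mem _ (⟨c, hc⟩ : NNReal) (Submodule.subset_span ⟨j, rfl⟩)
  have hself : ∀ i, 0 < f i (x i) := fun i => lt_of_le_of_ne (hnonneg _ _) <| by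
    rw [ne_comm, Ne, hzero]
    exact not_or.2 ⟨(hs _).symm, (hss _).symm⟩
  apply le_antisymm
  · intro y hy
    rw [hK] at hy
    obtain ⟨j⟩ := ‹Nonempty ι›
    have hfin : {i | 0 < f i (x j)}.Finite := Set.toFinite _
    -- Minimum ratio test: the least quotient is the largest admissible multiple of `x j`.
    obtain ⟨i, hi, hmin⟩ := Set.exists_min_image _ (fun i => f i y / f i (x j)) hfin ⟨j, hself j⟩
    simp only [Set.mem_ofPred_eq] at hi hmin
    set t := f i y / f i (x j) with ht
    have ht0 : 0 ≤ t := div_nonneg (hy i) hi.le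
    have hz : ∀ k, 0 ≤ f k (y - t • x j) := by
      intro k
      rw [map_sub, map_smul, smul_eq_mul, sub_nonneg]
      rcases (hnonneg k j).eq_or_lt with h | h
      · rw [← h, mul_zero]
        exact hy k
      · exact (le_div_iff₀ h).1 (hmin k h)
    have hz0 : f i (y - t • x j) = 0 := by
      rw [map_sub, map_smul, smul_eq_mul, ht, div_mul_cancel₀ _ hi.ne', sub_self]
    obtain ⟨a, b, hab⟩ := exists_eq_add_of_cyclicPairing hE s hs hss hzero i hz0
    have ha : 0 ≤ a := by
      have h := hz (s i)
      rw [hab, map_add, map_smul, map_smul, (hzero (s i) (s (s i))).2 (Or.inl rfl), smul_zero,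
        add_zero, smul_eq_mul] at h
      exact nonneg_of_mul_nonneg_left h (hself _)
    have hb : 0 ≤ b := by
      have h := hz (s.symm i)
      have h1 : 0 < f (s.symm i) (x (s (s i))) := lt_of_le_of_ne (hnonneg _ _) <| by
        rw [ne_comm, Ne, hzero]
        simp [hs, hss]
      rw [hab, map_add, map_smul, map_smul, (hzero (s.symm i) (s i)).2 (Or.inr (by simp)),
        smul_zero, zero_add, smul_eq_mul] at h
      exact nonneg_of_mul_nonneg_left h h1
    rw [← sub_add_cancel y (t • x j), hab]
    exact add_mem (add_mem (hx a _ ha) (hx b _ hb)) (hx t _ ht0)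
  · rw [PointedCone.hull, Submodule.span_le]
    rintro _ ⟨j, rfl⟩
    exact (hK _).2 fun i => hnonneg i j

/-- Each `x (s i)` spans the intersection of the kernels of `f i` and `f (s.symm i)`, which makes
its ray a face; this pair of functionals also distinguishes the rays. Any extreme ray contains a
generator, because its own generator is a nonnegative combination of the `x j`. -/
theorem extremeRays_bijOn_of_cyclicPairing {ι : Type*} [Finite ι] [Nonempty ι]
    (hE : Module.finrank ℝ E = 3)
    (s : Equiv.Perm ι) (hs : ∀ i, s i ≠ i) (hss : ∀ i, s (s i) ≠ i)
    {f : ι → Module.Dual ℝ E} {x : ι → E}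
    (hzero : ∀ i j, f i (x j) = 0 ↔ j = s i ∨ j = s (s i)) (hnonneg : ∀ i j, 0 ≤ f i (x j))
    {K : PointedCone ℝ E} (hK : ∀ y, y ∈ K ↔ ∀ i, 0 ≤ f i y) :
    Set.BijOn (fun j => coneRay (x j)) Set.univ (extremeRays K) := by
  have hself : ∀ i, 0 < f i (x i) := fun i => lt_of_le_of_ne (hnonneg _ _) <| by
    rw [ne_comm, Ne, hzero]
    exact not_or.2 ⟨(hs _).symm, (hss _).symm⟩
  have hx0 : ∀ j, x j ≠ 0 := by
    intro j h
    have := hself j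
    rw [h, map_zero] at this
    exact lt_irrefl _ this
  refine ⟨fun j _ => ⟨⟨?_, ?_⟩, x j, hx0 j, rfl⟩, ?_, ?_⟩
  · intro y hy
    obtain ⟨c, hc, rfl⟩ := mem_coneRay.1 hy
    refine (hK _).2 fun i => ?_
    rw [map_smul]
    exact mul_nonneg hc (hnonneg i j)
  · intro y z a hy hz ha h
    obtain ⟨c, hc, hcx⟩ := mem_coneRay.1 h
    rw [hK] at hy hz
    -- Two nonnegative terms with sum zero both vanish.
    have key : ∀ i, f i (x j) = 0 → f i y = 0 := by
      intro i hi
      have h1 := congrArg (f i) hcx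
      simp only [map_smul, map_add, hi, smul_eq_mul, mul_zero] at h1
      have h2 := mul_nonneg ha.le (hy i)
      have h3 : a * f i y = 0 := by linarith [hz i]
      exact (mul_eq_zero.1 h3).resolve_left ha.ne'
    obtain ⟨i, rfl⟩ := s.surjective j
    have hi1 : f i y = 0 := key _ ((hzero _ _).2 (Or.inl rfl))
    have hi2 : f (s.symm i) y = 0 := key _ ((hzero _ _).2 (Or.inr (by simp)))
    obtain ⟨p, q, rfl⟩ := exists_eq_add_of_cyclicPairing hE s hs hss hzero i hi1
    have h1 : f (s.symm i) (x (s (s i))) ≠ 0 := by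
      rw [Ne, hzero]
      simp [hs, hss]
    rw [map_add, map_smul, map_smul, (hzero (s.symm i) (s i)).2 (Or.inr (by simp)),
        smul_zero, zero_add, smul_eq_mul] at hi2
    have hq : q = 0 := (mul_eq_zero.1 hi2).resolve_right h1
    subst hq
    have h4 := hy (s i)
    rw [zero_smul, add_zero] at h4 ⊢
    rw [map_smul, smul_eq_mul] at h4
    exact mem_coneRay.2 ⟨p, nonneg_of_mul_nonneg_left h4 (hself _), rfl⟩
  · intro j _ k _ hjk
    have hjk : coneRay (x j) = coneRay (x k) := hjk
    have h1 : x j ∈ coneRay (x k) := hjk ▸ mem_coneRay.2 ⟨1, zero_le_one, one_smul _ _⟩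
    obtain ⟨c, -, hc⟩ := mem_coneRay.1 h1
    have hzz : ∀ i, f i (x k) = 0 → f i (x j) = 0 := by
      intro i hi
      rw [← hc, map_smul, hi, smul_zero]
    obtain ⟨i, rfl⟩ := s.surjective k
    have hj1 := (hzero _ _).1 (hzz i ((hzero _ _).2 (Or.inl rfl)))
    have hj2 := (hzero _ _).1 (hzz (s.symm i) ((hzero _ _).2 (Or.inr (by simp))))
    simp only [Equiv.apply_symm_apply] at hj2
    rcases hj1 with h | h
    · exact h
    · subst h
      rcases hj2 with h | h
      · exact absurd h (hss i)
      · exact absurd h (hs _)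
  · rintro R ⟨hface, y, hy0, rfl⟩
    have hyK : y ∈ K := hface.le (mem_coneRay.2 ⟨1, zero_le_one, one_smul _ _⟩)
    have hxK : ∀ j, x j ∈ K := fun j => (hK _).2 fun i => hnonneg i j
    have hy := hyK
    rw [hull_eq_of_cyclicPairing hE s hs hss hzero hnonneg hK] at hy
    have := Fintype.ofFinite ι
    obtain ⟨c, hc⟩ := (Submodule.mem_span_range_iff_exists_fun _).1 hy
    have hex : ∃ j, c j ≠ 0 := by
      by_contra! h
      apply hy0
      rw [← hc]
      simp [h]
    obtain ⟨j, hj⟩ := hex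
    have hsum : ∑ i, c i • x i ∈ coneRay y := by
      rw [hc]
      exact mem_coneRay.2 ⟨1, zero_le_one, one_smul _ _⟩
    have hmem : c j • x j ∈ coneRay y :=
      hface.mem_of_sum_mem (fun i => Submodule.smul_mem K (c i) (hxK i)) hsum j
    obtain ⟨d, hd, hdy⟩ := mem_coneRay.1 hmem
    have hcj : (0 : ℝ) < c j := lt_of_le_of_ne (c j).2 (fun h => hj (NNReal.eq h.symm))
    have hdy' : d • y = (c j : ℝ) • x j := hdy
    have hd0 : 0 < d := by
      refine lt_of_le_of_ne hd fun h => ?_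
      rw [← h, zero_smul] at hdy'
      exact (smul_ne_zero hcj.ne' (hx0 j)) hdy'.symm
    refine ⟨j, Set.mem_univ _, ?_⟩
    have e1 : x j = ((c j : ℝ)⁻¹ * d) • y := by
      rw [mul_smul, hdy', smul_smul, inv_mul_cancel₀ hcj.ne', one_smul]
    have e2 : y = (d⁻¹ * (c j : ℝ)) • x j := by
      rw [mul_smul, ← hdy', smul_smul, inv_mul_cancel₀ hd0.ne', one_smul]
    apply le_antisymm
    · refine Submodule.span_le.2 (Set.singleton_subset_iff.2 ?_)
      exact mem_coneRay.2 ⟨_, by positivity, e1.symm⟩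
    · refine Submodule.span_le.2 (Set.singleton_subset_iff.2 ?_)
      exact mem_coneRay.2 ⟨_, by positivity, e2.symm⟩

/-- A cyclic pairing in dimension three is a slack matrix of the cone `{y | ∀ i, 0 ≤ f i y}`. -/
theorem isSlackMatrix_of_cyclicPairing {n : ℕ} [NeZero n] (hE : Module.finrank ℝ E = 3)
    (s : Equiv.Perm (Fin n)) (hs : ∀ i, s i ≠ i) (hss : ∀ i, s (s i) ≠ i)
    {f : Fin n → Module.Dual ℝ E} {x : Fin n → E}
    (hzero : ∀ i j, f i (x j) = 0 ↔ j = s i ∨ j = s (s i)) (hnonneg : ∀ i j, 0 ≤ f i (x j)) :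
    ∃ K : PointedCone ℝ E, IsPolyhedralCone K ∧ (extremeRays K).ncard = n ∧
      IsSlackMatrix K (Matrix.of fun i j => f i (x j)) := by
  classical
  have : Module.Finite ℝ E := Module.finite_of_finrank_pos (by omega)
  let K : PointedCone ℝ E := PointedCone.dual LinearMap.id (Set.range f)
  have hK : ∀ y, y ∈ K ↔ ∀ i, 0 ≤ f i y := fun y => by simp [K]
  have hbij := extremeRays_bijOn_of_cyclicPairing hE s hs hss hzero hnonneg hK
  have hdual : ∀ g, g ∈ dualCone K ↔ ∀ j, 0 ≤ Module.Dual.eval ℝ E (x j) g := by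
    intro g
    rw [dualCone, hull_eq_of_cyclicPairing hE s hs hss hzero hnonneg hK, PointedCone.dual_hull]
    simp
  refine ⟨K, ⟨Finset.univ.image f, fun y => by simp [hK]⟩, ?_, x, f, hbij, ?_, fun i j => rfl⟩
  · rw [← hbij.image_eq, hbij.injOn.ncard_image, Set.ncard_univ, Nat.card_eq_fintype_card,
      Fintype.card_fin]
  -- The hypotheses are self-dual: the transposed pairing is cyclic for `s.symm`.
  · refine extremeRays_bijOn_of_cyclicPairing (f := fun j => Module.Dual.eval ℝ E (x j))
      ((Subspace.dual_finrank_eq).trans hE) s.symm ?_ ?_ ?_ ?_ hdual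
    · intro i h
      exact hs i ((Equiv.symm_apply_eq _).1 h).symm
    · intro i h
      exact hss i ((Equiv.symm_apply_eq _).1 ((Equiv.symm_apply_eq _).1 h)).symm
    · intro j i
      rw [Module.Dual.eval_apply, hzero, Equiv.eq_symm_apply, Equiv.eq_symm_apply,
        Equiv.eq_symm_apply, eq_comm (a := j), eq_comm (a := j)]
    · intro j i
      exact hnonneg i j

end CyclicPairing

/-! ### Faces of the semi-definite cone as semi-definite cones of smaller order. -/

section Congruence

/-- The congruence transformation `S ↦ Nᵀ S N`. -/
def congruence {k m : ℕ} (N : Matrix (Fin k) (Fin m) ℝ) :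
    Matrix (Fin k) (Fin k) ℝ →ₗ[ℝ] Matrix (Fin m) (Fin m) ℝ where
  toFun S := Nᵀ * S * N
  map_add' S T := by rw [Matrix.mul_add, Matrix.add_mul]
  map_smul' c S := by simp

theorem congruence_apply {k m : ℕ} (N : Matrix (Fin k) (Fin m) ℝ) (S : Matrix (Fin k) (Fin k) ℝ) :
    congruence N S = Nᵀ * S * N := rfl

theorem congruence_congruence {k m l : ℕ} (N : Matrix (Fin k) (Fin m) ℝ)
    (M : Matrix (Fin l) (Fin k) ℝ) (S : Matrix (Fin l) (Fin l) ℝ) :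
    congruence N (congruence M S) = congruence (M * N) S := by
  simp only [congruence_apply, Matrix.transpose_mul, Matrix.mul_assoc]

theorem congruence_one {k : ℕ} (S : Matrix (Fin k) (Fin k) ℝ) : congruence 1 S = S := by
  simp [congruence_apply]

theorem congruence_injective {k m : ℕ} {N : Matrix (Fin k) (Fin m) ℝ}
    {E : Matrix (Fin m) (Fin k) ℝ} (h : N * E = 1) : Function.Injective (congruence N) := by
  intro S T hST
  rw [← congruence_one S, ← congruence_one T, ← h, ← congruence_congruence, hST,
    congruence_congruence]

theorem congruence_mem_psdCone {k m : ℕ} (N : Matrix (Fin k) (Fin m) ℝ)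
    {S : Matrix (Fin k) (Fin k) ℝ} (hS : S ∈ psdCone k) : congruence N S ∈ psdCone m := by
  have := Matrix.PosSemidef.conjTranspose_mul_mul_same hS N
  rwa [Matrix.conjTranspose_eq_transpose_of_trivial] at this

theorem rank_congruence_le {k m : ℕ} (N : Matrix (Fin k) (Fin m) ℝ)
    (S : Matrix (Fin k) (Fin k) ℝ) : (congruence N S).rank ≤ S.rank :=
  (Matrix.rank_mul_le_left (Nᵀ * S) N).trans (Matrix.rank_mul_le_right Nᵀ S)

theorem rank_congruence {k m : ℕ} {N : Matrix (Fin k) (Fin m) ℝ}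
    {E : Matrix (Fin m) (Fin k) ℝ} (h : N * E = 1) (S : Matrix (Fin k) (Fin k) ℝ) :
    (congruence N S).rank = S.rank := by
  refine le_antisymm (rank_congruence_le N S) ?_
  conv_lhs => rw [← congruence_one S, ← h, ← congruence_congruence]
  exact rank_congruence_le _ _

theorem rank_image_psdCone (k : ℕ) : Matrix.rank '' psdCone k = Set.Iic k := by
  ext r
  constructor
  · rintro ⟨S, -, rfl⟩
    exact S.rank_le_width
  · intro hr
    refine ⟨Matrix.diagonal fun i : Fin k => if (i : ℕ) < r then 1 else 0, ?_, ?_⟩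
    · exact Matrix.posSemidef_diagonal_iff.2 fun i => by split_ifs <;> norm_num
    · classical
      rw [Matrix.rank_diagonal, Fintype.card_subtype]
      simp only [ne_eq, ite_eq_right_iff, one_ne_zero, imp_false, not_not]
      rw [Fin.card_filter_val_lt]
      exact min_eq_right hr

/-- The image of a set under an injective linear map has an isomorphic linear span. -/
theorem linearlyIsomorphicCones_image {V W : Type*} [AddCommGroup V] [Module ℝ V]
    [AddCommGroup W] [Module ℝ W] {φ : V →ₗ[ℝ] W} (hφ : Function.Injective φ) (C : Set V) :
    LinearlyIsomorphicCones (φ '' C) C := by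
  let e : Submodule.span ℝ C ≃ₗ[ℝ] Submodule.span ℝ (φ '' C) :=
    (Submodule.equivMapOfInjective φ hφ (Submodule.span ℝ C)).trans
      (LinearEquiv.ofEq _ _ (Submodule.map_span φ C))
  have he : ∀ y, (e y : W) = φ y := fun y => rfl
  refine ⟨e.symm, fun x => ?_⟩
  obtain ⟨y, rfl⟩ := e.surjective x
  rw [LinearEquiv.symm_apply_apply, he, hφ.mem_set_image]

theorem LinearlyIsomorphicCones.finrank_eq {V W : Type*} [AddCommGroup V] [Module ℝ V]
    [AddCommGroup W] [Module ℝ W] {C : Set V} {D : Set W} (h : LinearlyIsomorphicCones C D) :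
    Module.finrank ℝ (Submodule.span ℝ C) = Module.finrank ℝ (Submodule.span ℝ D) := by
  obtain ⟨φ, -⟩ := h
  exact φ.finrank_eq

/-- This recovers the order `k` from the isomorphism class of the cone. Padding by a zero row and
column embeds each cone in the next, and the identity is outside the span of the image. -/
theorem strictMono_finrank_span_psdCone :
    StrictMono fun k => Module.finrank ℝ (Submodule.span ℝ (psdCone k)) := by
  refine strictMono_nat_of_lt_succ fun k => ?_
  let C : Matrix (Fin k) (Fin (k + 1)) ℝ := Matrix.of fun i j => if j = i.castSucc then 1 else 0
  have hC : C * Cᵀ = 1 := by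
    ext i j
    simp [C, Matrix.mul_apply, Matrix.one_apply, eq_comm]
  rw [← (linearlyIsomorphicCones_image (congruence_injective hC) (psdCone k)).finrank_eq]
  apply Submodule.finrank_lt_finrank_of_lt
  refine lt_of_le_of_ne (Submodule.span_mono ?_) fun h => ?_
  · rintro _ ⟨S, hS, rfl⟩
    exact congruence_mem_psdCone C hS
  · have h1 : (1 : Matrix (Fin (k + 1)) (Fin (k + 1)) ℝ) ∈ Submodule.span ℝ (psdCone (k + 1)) :=
      Submodule.subset_span Matrix.PosSemidef.one
    rw [← h, ← Submodule.map_span] at h1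
    obtain ⟨S, -, hS⟩ := h1
    have h2 := congrFun (congrFun hS (Fin.last k)) (Fin.last k)
    rw [congruence_apply, Matrix.mul_apply, Matrix.one_apply_eq] at h2
    refine zero_ne_one ((Finset.sum_eq_zero fun i _ => ?_).symm.trans h2)
    simp [C, (Fin.castSucc_ne_last i).symm]

/-- Coordinates `N` on the quotient by a subspace, with a section `E`. -/
theorem exists_quotient_coordinates {n k : ℕ} (L : Submodule ℝ (Fin n → ℝ))
    (hk : k + Module.finrank ℝ L = n) :
    ∃ (N : Matrix (Fin k) (Fin n) ℝ) (E : Matrix (Fin n) (Fin k) ℝ), N * E = 1 ∧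
      (∀ v ∈ L, N *ᵥ v = 0) ∧ ∀ x, x - E *ᵥ (N *ᵥ x) ∈ L := by
  obtain ⟨Q, hQ⟩ := Submodule.exists_isCompl L
  have hQk : Module.finrank ℝ Q = k := by
    have := Submodule.finrank_add_eq_of_isCompl hQ
    rw [Module.finrank_fin_fun] at this
    omega
  -- `N` is the projection onto the complement `Q` along `L`, read in the basis `b`; `E` is the
  -- inclusion of `Q`.
  let b := Module.finBasisOfFinrankEq ℝ Q hQk
  refine ⟨LinearMap.toMatrix' (b.equivFun.toLinearMap ∘ₗ Submodule.projectionOnto Q L hQ.symm),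
    LinearMap.toMatrix' (Q.subtype ∘ₗ b.equivFun.symm.toLinearMap), ?_, ?_, ?_⟩
  · rw [← LinearMap.toMatrix'_comp, ← LinearMap.toMatrix'_id]
    congr 1
    ext i : 1
    ext j
    simp [Pi.single_apply, eq_comm]
  · intro v hv
    rw [LinearMap.toMatrix'_mulVec]
    simp [hv]
  · intro x
    rw [LinearMap.toMatrix'_mulVec, LinearMap.toMatrix'_mulVec]
    rw [← Submodule.projection_apply_eq_zero_iff hQ.symm]
    simp [Submodule.projection_apply_of_mem_left]

/-- A zero of a positive semi-definite form is in the kernel of its matrix, so `A` kills the whole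
span and is unchanged by `E * N` on either side. -/
theorem psdFace_eq_image {n k : ℕ} {u : Fin n → Fin n → ℝ} {N : Matrix (Fin k) (Fin n) ℝ}
    {E : Matrix (Fin n) (Fin k) ℝ} (hN : ∀ j, N *ᵥ u j = 0)
    (hE : ∀ x, x - E *ᵥ (N *ᵥ x) ∈ Submodule.span ℝ (Set.range u)) :
    psdFace u = congruence N '' psdCone k := by
  ext A
  constructor
  · rintro ⟨hA, hu⟩
    have hA' : A.PosSemidef := hA
    have hker : Submodule.span ℝ (Set.range u) ≤ LinearMap.ker A.mulVecLin := by
      rw [Submodule.span_le]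
      rintro _ ⟨j, rfl⟩
      exact (hA'.dotProduct_mulVec_zero_iff (u j)).1 (hu j)
    have hAEN : A * (E * N) = A := by
      refine Matrix.ext_iff_mulVec.2 fun x => ?_
      have := hker (hE x)
      rw [LinearMap.mem_ker, map_sub, sub_eq_zero] at this
      rw [← Matrix.mulVec_mulVec, ← Matrix.mulVec_mulVec]
      exact this.symm
    refine ⟨congruence E A, congruence_mem_psdCone E hA, ?_⟩
    rw [congruence_congruence, congruence_apply, Matrix.mul_assoc, hAEN]
    have hT : Aᵀ = A := hA'.isHermitian
    conv_lhs => rw [← hT, ← Matrix.transpose_mul, hAEN, hT]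
  · rintro ⟨S, hS, rfl⟩
    refine ⟨congruence_mem_psdCone N hS, fun j => ?_⟩
    rw [congruence_apply, ← Matrix.mulVec_mulVec, hN, Matrix.mulVec_zero, dotProduct_zero]

theorem rank_image_psdFace {n k : ℕ} (u : Fin n → Fin n → ℝ)
    (hk : k + Module.finrank ℝ (Submodule.span ℝ (Set.range u)) = n) :
    Matrix.rank '' psdFace u = Set.Iic k := by
  obtain ⟨N, E, hNE, hN, hE⟩ := exists_quotient_coordinates _ hk
  rw [psdFace_eq_image (fun j => hN _ (Submodule.subset_span ⟨j, rfl⟩)) hE, Set.image_image,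
    ← rank_image_psdCone]
  simp only [rank_congruence hNE]

theorem linearlyIsomorphicCones_psdFace {n k : ℕ} (u : Fin n → Fin n → ℝ)
    (hk : k + Module.finrank ℝ (Submodule.span ℝ (Set.range u)) = n) :
    LinearlyIsomorphicCones (psdFace u) (psdCone k) := by
  obtain ⟨N, E, hNE, hN, hE⟩ := exists_quotient_coordinates _ hk
  rw [psdFace_eq_image (fun j => hN _ (Submodule.subset_span ⟨j, rfl⟩)) hE]
  exact linearlyIsomorphicCones_image (congruence_injective hNE) _

end Congruence

/-! ### First and second order conditions at a zero of a copositive form. -/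

section Copositive

/-- At a zero `v` of a copositive form, the form is positive semi-definite and orthogonal to `v` on
vectors supported in the support of `v`. -/
theorem copositive_zero_support {n : ℕ} {A : Matrix (Fin n) (Fin n) ℝ} (hA : A ∈ copositiveCone n)
    {v : Fin n → ℝ} (hv : ∀ i, 0 ≤ v i) (hvA : v ⬝ᵥ (A *ᵥ v) = 0) {x : Fin n → ℝ}
    (hx : ∀ i, v i = 0 → x i = 0) : x ⬝ᵥ (A *ᵥ v) = 0 ∧ 0 ≤ x ⬝ᵥ (A *ᵥ x) := by
  obtain ⟨hsymm, hcop⟩ := hA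
  have hswap : v ⬝ᵥ (A *ᵥ x) = x ⬝ᵥ (A *ᵥ v) := by
    rw [Matrix.dotProduct_mulVec, ← Matrix.mulVec_transpose, hsymm, dotProduct_comm]
  have hexp : ∀ t : ℝ, (v + t • x) ⬝ᵥ (A *ᵥ (v + t • x)) =
      2 * (x ⬝ᵥ (A *ᵥ v)) * t + (x ⬝ᵥ (A *ᵥ x)) * t ^ 2 := by
    intro t
    simp only [Matrix.mulVec_add, Matrix.mulVec_smul, add_dotProduct, dotProduct_add,
      smul_dotProduct, dotProduct_smul, smul_eq_mul, hvA, hswap]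
    ring
  have hev : ∀ᶠ t in nhds (0 : ℝ),
      0 ≤ 2 * (x ⬝ᵥ (A *ᵥ v)) * t + (x ⬝ᵥ (A *ᵥ x)) * t ^ 2 := by
    -- Small perturbations of both signs stay in the orthant, so the quadratic in `t` has a local
    -- minimum at 0: its linear coefficient vanishes, then its leading one is nonnegative.
    have h : ∀ᶠ t in nhds (0 : ℝ), ∀ i, 0 ≤ v i + t * x i := by
      refine Filter.eventually_all.2 fun i => ?_
      rcases (hv i).eq_or_lt with h | h
      · simp [← h, hx i h.symm]
      · have hc : Filter.Tendsto (fun t : ℝ => v i + t * x i) (nhds 0) (nhds (v i + 0 * x i)) :=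
          Continuous.tendsto (by fun_prop) 0
        rw [zero_mul, add_zero] at hc
        exact (hc.eventually_const_lt h).mono fun t ht => ht.le
    refine h.mono fun t ht => ?_
    rw [← hexp]
    exact hcop _ ht
  have hb : x ⬝ᵥ (A *ᵥ v) = 0 := by
    have hmin : IsLocalMin
        (fun t : ℝ => 2 * (x ⬝ᵥ (A *ᵥ v)) * t + (x ⬝ᵥ (A *ᵥ x)) * t ^ 2) 0 := by
      refine hev.mono fun t ht => ?_
      simpa using ht
    have hd : HasDerivAt (fun t : ℝ => 2 * (x ⬝ᵥ (A *ᵥ v)) * t + (x ⬝ᵥ (A *ᵥ x)) * t ^ 2)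
        (2 * (x ⬝ᵥ (A *ᵥ v)) * 1 + (x ⬝ᵥ (A *ᵥ x)) * (2 * 0 ^ (2 - 1) * 1)) 0 :=
      ((hasDerivAt_id' (0 : ℝ)).const_mul _).add (((hasDerivAt_id' (0 : ℝ)).pow 2).const_mul _)
    have := hmin.hasDerivAt_eq_zero hd
    simpa using this
  refine ⟨hb, ?_⟩
  obtain ⟨t, ht, ht0⟩ := ((hev.filter_mono nhdsWithin_le_nhds).and
    (self_mem_nhdsWithin : Set.Ioi (0 : ℝ) ∈ nhdsWithin 0 (Set.Ioi 0))).exists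
  rw [hb, mul_zero, zero_mul, zero_add] at ht
  exact nonneg_of_mul_nonneg_left ht (pow_pos ht0 2)

end Copositive

/-! ### Combinatorics of the cyclic supports. -/

section CyclicSupport

variable {n : ℕ}

theorem mem_cyclicSupport_iff (hn : 2 ≤ n) {i j : Fin n} : i ∈ cyclicSupport n j ↔
    ((j : ℕ) ≤ i ∧ (i : ℕ) + 2 < j + n) ∨ (i : ℕ) + 2 < j := by
  have hi := i.2
  have hj := j.2
  constructor
  · rintro ⟨k, hk, h⟩
    rcases lt_or_ge ((j : ℕ) + k) n with h1 | h1
    · rw [Nat.mod_eq_of_lt h1] at h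
      omega
    · rw [Nat.mod_eq_sub_mod h1, Nat.mod_eq_of_lt (by omega)] at h
      omega
  · rintro (⟨h, h'⟩ | h)
    · exact ⟨i - j, by omega, by rw [Nat.mod_eq_of_lt] <;> omega⟩
    · refine ⟨i + n - j, by omega, ?_⟩
      rw [Nat.mod_eq_sub_mod (by omega), Nat.mod_eq_of_lt] <;> omega

theorem val_add_one_eq (hn : 2 ≤ n) [NeZero n] (i : Fin n) :
    ((i + 1 : Fin n) : ℕ) = if (i : ℕ) + 1 = n then 0 else (i : ℕ) + 1 := by
  have hi := i.2
  rw [Fin.val_add, Fin.val_one', Nat.mod_eq_of_lt (show 1 < n by omega)]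
  split_ifs with h
  · rw [h, Nat.mod_self]
  · rw [Nat.mod_eq_of_lt (by omega)]

theorem notMem_cyclicSupport_iff (hn : 3 ≤ n) [NeZero n] {i j : Fin n} :
    i ∉ cyclicSupport n j ↔ j = i + 1 ∨ j = i + 1 + 1 := by
  have hi := i.2
  have hj := j.2
  have h1 := val_add_one_eq (by omega) i
  have h2 := val_add_one_eq (by omega) (i + 1)
  rw [mem_cyclicSupport_iff (by omega), Fin.ext_iff, Fin.ext_iff, h2, h1]
  split_ifs <;> omega

variable {u : Fin n → Fin n → ℝ}

theorem eq_zero_iff_notMem_cyclicSupport (hu_nonneg : ∀ j i, 0 ≤ u j i)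
    (hu_supp : ∀ j, {i | 0 < u j i} = cyclicSupport n j) {i j : Fin n} :
    u j i = 0 ↔ i ∉ cyclicSupport n j := by
  rw [← hu_supp, Set.mem_ofPred_eq, not_lt]
  exact ⟨fun h => h.le, fun h => le_antisymm h (hu_nonneg j i)⟩

/-- A symmetric matrix that vanishes on the leading `n - 3` indices and annihilates each `u j`
on its support is zero. -/
theorem eq_zero_of_mulVec_cyclicSupport (hn : 5 ≤ n) (hu_nonneg : ∀ j i, 0 ≤ u j i)
    (hu_supp : ∀ j, {i | 0 < u j i} = cyclicSupport n j) {D : Matrix (Fin n) (Fin n) ℝ}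
    (hsymm : D.IsSymm) (hD : ∀ j, ∀ i ∈ cyclicSupport n j, (D *ᵥ u j) i = 0)
    (h0 : ∀ k l : Fin n, (k : ℕ) < n - 3 → (l : ℕ) < n - 3 → D k l = 0) : D = 0 := by
  have hn0 : 0 < n := by omega
  -- Indexing the cycle by natural numbers lets a window of consecutive indices be shifted by
  -- induction.
  let c : ℕ → Fin n := fun k => ⟨k % n, Nat.mod_lt _ hn0⟩
  have hsupp : ∀ j p, p ∈ cyclicSupport n (c j) ↔ ∃ k, k < n - 2 ∧ p = c (j + k) := by
    intro j p
    simp only [cyclicSupport, c, Set.mem_ofPred_eq, Fin.ext_iff, Nat.mod_add_mod]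
  -- Only the last index of the support survives in row `p` of `D *ᵥ u (c j)`, and its coefficient
  -- is positive.
  have hlast : ∀ j p, p ∈ cyclicSupport n (c j) → (∀ a, a < n - 3 → D p (c (j + a)) = 0) →
      D p (c (j + (n - 3))) = 0 := by
    intro j p hp ha
    have hmem : c (j + (n - 3)) ∈ cyclicSupport n (c j) := (hsupp _ _).2 ⟨_, by omega, rfl⟩
    have h := hD (c j) p hp
    rw [Matrix.mulVec, dotProduct, Finset.sum_eq_single (c (j + (n - 3)))] at h
    · refine (mul_eq_zero.1 h).resolve_right ?_
      rw [eq_zero_iff_notMem_cyclicSupport hu_nonneg hu_supp, not_not]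
      exact hmem
    · intro q _ hq
      by_cases hqs : q ∈ cyclicSupport n (c j)
      · obtain ⟨k, hk, rfl⟩ := (hsupp _ _).1 hqs
        have : k ≠ n - 3 := fun h => hq (by rw [h])
        rw [ha k (by omega), zero_mul]
      · rw [(eq_zero_iff_notMem_cyclicSupport hu_nonneg hu_supp).2 hqs, mul_zero]
    · simp
  -- A zero block on a window of length `n - 3` grows to length `n - 2`: first the new column, by
  -- symmetry the new row, then the corner. The larger window contains the smaller one starting at
  -- `j + 1`.
  have hstep : ∀ j, (∀ a b, a < n - 3 → b < n - 3 → D (c (j + a)) (c (j + b)) = 0) →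
      ∀ a b, a < n - 2 → b < n - 2 → D (c (j + a)) (c (j + b)) = 0 := by
    intro j hP
    have h1 : ∀ a, a < n - 3 → D (c (j + a)) (c (j + (n - 3))) = 0 := fun a ha =>
      hlast j _ ((hsupp _ _).2 ⟨a, by omega, rfl⟩) fun b hb => hP a b ha hb
    have h2 : ∀ a, a < n - 3 → D (c (j + (n - 3))) (c (j + a)) = 0 := fun a ha => by
      rw [hsymm.apply]
      exact h1 a ha
    have h3 := hlast j _ ((hsupp _ _).2 ⟨n - 3, by omega, rfl⟩) h2
    intro a b ha hb
    rcases eq_or_ne a (n - 3) with rfl | ha'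
    · rcases eq_or_ne b (n - 3) with rfl | hb'
      · exact h3
      · exact h2 b (by omega)
    · rcases eq_or_ne b (n - 3) with rfl | hb'
      · exact h1 a (by omega)
      · exact hP a b (by omega) (by omega)
  have hP : ∀ j, ∀ a b, a < n - 3 → b < n - 3 → D (c (j + a)) (c (j + b)) = 0 := by
    intro j
    induction j with
    | zero =>
      intro a b ha hb
      refine h0 _ _ ?_ ?_ <;>
      · simp only [c, zero_add]
        rwa [Nat.mod_eq_of_lt (by omega)]
    | succ j ih =>
      intro a b ha hb
      have := hstep j ih (1 + a) (1 + b) (by omega) (by omega)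
      rwa [← add_assoc, ← add_assoc] at this
  have hval : ∀ p : Fin n, c p = p := fun p => Fin.ext (Nat.mod_eq_of_lt p.2)
  have hval' : ∀ p : Fin n, c (p + n) = p := fun p =>
    Fin.ext (by simp only [c, Nat.add_mod_right]; exact Nat.mod_eq_of_lt p.2)
  -- Every pair lies in one window of length `n - 2`, starting at `p` or, going round, at `q`. In
  -- the second case the cyclic distance is at most 2, which is less than `n - 2` because `n ≥ 5`.
  have hle : ∀ p q : Fin n, (p : ℕ) ≤ q → D p q = 0 := by
    intro p q hpq
    have hq := q.2
    rcases lt_or_ge ((q : ℕ) - p) (n - 2) with h | h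
    · have := hstep p (hP p) 0 (q - p) (by omega) h
      rwa [add_zero, Nat.add_sub_cancel' hpq, hval, hval] at this
    · have := hstep q (hP q) (p + n - q) 0 (by omega) (by omega)
      rwa [add_zero, Nat.add_sub_cancel' (by omega), hval, hval'] at this
  ext p q
  rcases le_total (p : ℕ) q with h | h
  · exact hle p q h
  · rw [← hsymm.apply]
    exact hle q p h


/-- The supports of the first three vectors end at `n - 3`, `n - 2` and `n - 1`, so the system is
triangular with positive diagonal. -/
theorem eq_zero_of_trailing_eq_zero (hn : 5 ≤ n) (hu_nonneg : ∀ j i, 0 ≤ u j i)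
    (hu_supp : ∀ j, {i | 0 < u j i} = cyclicSupport n j) {a b c : ℝ}
    (h : ∀ i : Fin n, n - 3 ≤ (i : ℕ) →
      a * u ⟨0, by omega⟩ i + b * u ⟨1, by omega⟩ i + c * u ⟨2, by omega⟩ i = 0) :
    a = 0 ∧ b = 0 ∧ c = 0 := by
  have hz := @eq_zero_iff_notMem_cyclicSupport n u hu_nonneg hu_supp
  simp only [mem_cyclicSupport_iff (show 2 ≤ n by omega)] at hz
  have h1 := h ⟨n - 1, by omega⟩ (by simp only; omega)
  have h2 := h ⟨n - 2, by omega⟩ (by simp only; omega)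
  have h3 := h ⟨n - 3, by omega⟩ (by simp only; omega)
  rw [hz.2 (by simp only; omega), hz.2 (by simp only; omega), mul_zero, mul_zero, zero_add,
    zero_add] at h1
  have hc := (mul_eq_zero.1 h1).resolve_right (by rw [hz]; simp only; omega)
  subst hc
  rw [hz.2 (by simp only; omega), mul_zero, zero_mul, zero_add, add_zero] at h2
  have hb := (mul_eq_zero.1 h2).resolve_right (by rw [hz]; simp only; omega)
  subst hb
  rw [zero_mul, zero_mul, add_zero, add_zero] at h3
  exact ⟨(mul_eq_zero.1 h3).resolve_right (by rw [hz]; simp only; omega), rfl, rfl⟩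

end CyclicSupport

/-! ### The case of a three-dimensional span. -/

section Faces

theorem dotProduct_congruence_mulVec {k m : ℕ} (N : Matrix (Fin k) (Fin m) ℝ)
    (S : Matrix (Fin k) (Fin k) ℝ) (x y : Fin m → ℝ) :
    x ⬝ᵥ (congruence N S *ᵥ y) = (N *ᵥ x) ⬝ᵥ (S *ᵥ (N *ᵥ y)) := by
  rw [congruence_apply, ← Matrix.mulVec_mulVec, ← Matrix.mulVec_mulVec, Matrix.dotProduct_mulVec,
    Matrix.vecMul_transpose]

theorem psdCone_subset_copositiveCone (n : ℕ) : psdCone n ⊆ copositiveCone n :=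
  fun _ hA => ⟨Matrix.PosSemidef.isHermitian hA,
    fun x _ => Matrix.PosSemidef.dotProduct_mulVec_nonneg hA x⟩

variable {n : ℕ} {u : Fin n → Fin n → ℝ}

theorem psdFace_subset_copositiveFace : psdFace u ⊆ copositiveFace u :=
  fun _ hA => ⟨psdCone_subset_copositiveCone n hA.1, hA.2⟩

theorem copositiveFace_eq_psdFace_iff :
    copositiveFace u = psdFace u ↔ ∀ A ∈ copositiveFace u, A.PosSemidef :=
  ⟨fun h _ hA => (h ▸ hA : _ ∈ psdFace u).1,
    fun h => Set.Subset.antisymm (fun A hA => ⟨h A hA, hA.2⟩) psdFace_subset_copositiveFace⟩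

theorem linearIndependent_of_cyclicSupport (hn : 5 ≤ n) (hu_nonneg : ∀ j i, 0 ≤ u j i)
    (hu_supp : ∀ j, {i | 0 < u j i} = cyclicSupport n j) :
    LinearIndependent ℝ ![u ⟨0, by omega⟩, u ⟨1, by omega⟩, u ⟨2, by omega⟩] := by
  rw [Fintype.linearIndependent_iff]
  intro g hg
  simp only [Fin.sum_univ_three, Matrix.cons_val] at hg
  obtain ⟨h0, h1, h2⟩ := eq_zero_of_trailing_eq_zero hn hu_nonneg hu_supp
    fun i _ => congrFun hg i
  intro k
  fin_cases k <;> assumption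

theorem range_subset_range_of_first_three (hn : 5 ≤ n) (u : Fin n → Fin n → ℝ) :
    Set.range ![u ⟨0, by omega⟩, u ⟨1, by omega⟩, u ⟨2, by omega⟩] ⊆ Set.range u := by
  rintro _ ⟨k, rfl⟩
  fin_cases k <;> exact ⟨_, rfl⟩

theorem three_le_finrank_span (hn : 5 ≤ n) (hu_nonneg : ∀ j i, 0 ≤ u j i)
    (hu_supp : ∀ j, {i | 0 < u j i} = cyclicSupport n j) :
    3 ≤ Module.finrank ℝ (Submodule.span ℝ (Set.range u)) := by
  have h := finrank_span_eq_card (linearIndependent_of_cyclicSupport hn hu_nonneg hu_supp)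
  rw [Fintype.card_fin] at h
  refine h.ge.trans ?_
  exact Submodule.finrank_mono (Submodule.span_mono (range_subset_range_of_first_three hn u))

theorem span_range_eq_of_finrank_eq_three (hn : 5 ≤ n) (hu_nonneg : ∀ j i, 0 ≤ u j i)
    (hu_supp : ∀ j, {i | 0 < u j i} = cyclicSupport n j)
    (h3 : Module.finrank ℝ (Submodule.span ℝ (Set.range u)) = 3) :
    Submodule.span ℝ (Set.range ![u ⟨0, by omega⟩, u ⟨1, by omega⟩, u ⟨2, by omega⟩]) =
      Submodule.span ℝ (Set.range u) := by
  refine Submodule.eq_of_le_of_finrank_eq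
    (Submodule.span_mono (range_subset_range_of_first_three hn u)) ?_
  rw [h3, finrank_span_eq_card (linearIndependent_of_cyclicSupport hn hu_nonneg hu_supp),
    Fintype.card_fin]

/-- The vectors supported on the leading `n - 3` coordinates. -/
def leadingCoordinates (n : ℕ) : Submodule ℝ (Fin n → ℝ) where
  carrier := {x | ∀ i : Fin n, n - 3 ≤ (i : ℕ) → x i = 0}
  add_mem' hx hy i hi := by rw [Pi.add_apply, hx i hi, hy i hi, add_zero]
  zero_mem' _ _ := rfl
  smul_mem' c x hx i hi := by rw [Pi.smul_apply, hx i hi, smul_zero]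

theorem isCompl_leadingCoordinates (hn : 5 ≤ n) (hu_nonneg : ∀ j i, 0 ≤ u j i)
    (hu_supp : ∀ j, {i | 0 < u j i} = cyclicSupport n j)
    (h3 : Module.finrank ℝ (Submodule.span ℝ (Set.range u)) = 3) :
    IsCompl (leadingCoordinates n) (Submodule.span ℝ (Set.range u)) := by
  constructor
  · rw [Submodule.disjoint_def]
    intro x hx hxL
    rw [← span_range_eq_of_finrank_eq_three hn hu_nonneg hu_supp h3] at hxL
    obtain ⟨g, rfl⟩ := (Submodule.mem_span_range_iff_exists_fun ℝ).1 hxL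
    simp only [Fin.sum_univ_three, Matrix.cons_val] at hx ⊢
    obtain ⟨h0, h1, h2⟩ := eq_zero_of_trailing_eq_zero hn hu_nonneg hu_supp
      fun i hi => hx i hi
    rw [h0, h1, h2]
    simp
  · rw [codisjoint_iff, Submodule.eq_top_iff']
    intro x
    have hz := @eq_zero_iff_notMem_cyclicSupport n u hu_nonneg hu_supp
    simp only [mem_cyclicSupport_iff (show 2 ≤ n by omega)] at hz
    have hmem : ∀ j, u j ∈ Submodule.span ℝ (Set.range u) := fun j =>
      Submodule.subset_span ⟨j, rfl⟩
    have p0 : u ⟨0, by omega⟩ ⟨n - 3, by omega⟩ ≠ 0 := by rw [Ne, hz]; simp only; omega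
    have p1 : u ⟨1, by omega⟩ ⟨n - 2, by omega⟩ ≠ 0 := by rw [Ne, hz]; simp only; omega
    have p2 : u ⟨2, by omega⟩ ⟨n - 1, by omega⟩ ≠ 0 := by rw [Ne, hz]; simp only; omega
    have z01 : u ⟨0, by omega⟩ ⟨n - 1, by omega⟩ = 0 := by rw [hz]; simp only; omega
    have z02 : u ⟨0, by omega⟩ ⟨n - 2, by omega⟩ = 0 := by rw [hz]; simp only; omega
    have z11 : u ⟨1, by omega⟩ ⟨n - 1, by omega⟩ = 0 := by rw [hz]; simp only; omega
    -- Back substitution from the last coordinate.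
    obtain ⟨c, hc⟩ : ∃ c, x ⟨n - 1, by omega⟩ = c * u ⟨2, by omega⟩ ⟨n - 1, by omega⟩ :=
      ⟨_, (div_mul_cancel₀ _ p2).symm⟩
    obtain ⟨b, hb⟩ : ∃ b, x ⟨n - 2, by omega⟩ - c * u ⟨2, by omega⟩ ⟨n - 2, by omega⟩ =
        b * u ⟨1, by omega⟩ ⟨n - 2, by omega⟩ := ⟨_, (div_mul_cancel₀ _ p1).symm⟩
    obtain ⟨a, ha⟩ : ∃ a, x ⟨n - 3, by omega⟩ - c * u ⟨2, by omega⟩ ⟨n - 3, by omega⟩ -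
        b * u ⟨1, by omega⟩ ⟨n - 3, by omega⟩ = a * u ⟨0, by omega⟩ ⟨n - 3, by omega⟩ :=
      ⟨_, (div_mul_cancel₀ _ p0).symm⟩
    refine Submodule.mem_sup.2 ⟨x - (a • u ⟨0, by omega⟩ + b • u ⟨1, by omega⟩ +
      c • u ⟨2, by omega⟩), ?_, a • u ⟨0, by omega⟩ + b • u ⟨1, by omega⟩ +
      c • u ⟨2, by omega⟩, ?_, sub_add_cancel _ _⟩
    · intro i hi
      simp only [Pi.sub_apply, Pi.add_apply, Pi.smul_apply, smul_eq_mul]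
      have hi' := i.2
      obtain h | h | h : (i : ℕ) = n - 3 ∨ (i : ℕ) = n - 2 ∨ (i : ℕ) = n - 1 := by omega
      · rw [show i = ⟨n - 3, by omega⟩ from Fin.ext h]
        linarith
      · rw [show i = ⟨n - 2, by omega⟩ from Fin.ext h]
        rw [z02]
        linarith
      · rw [show i = ⟨n - 1, by omega⟩ from Fin.ext h]
        rw [z01, z11]
        linarith
    · exact add_mem (add_mem (Submodule.smul_mem _ _ (hmem _)) (Submodule.smul_mem _ _ (hmem _)))
        (Submodule.smul_mem _ _ (hmem _))

/-- If the vectors `u j` span a space of dimension three, a copositive form vanishing on them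
coincides with the positive semi-definite form obtained by projecting along their span. -/
theorem posSemidef_of_mem_copositiveFace (hn : 5 ≤ n) (hu_nonneg : ∀ j i, 0 ≤ u j i)
    (hu_supp : ∀ j, {i | 0 < u j i} = cyclicSupport n j)
    (h3 : Module.finrank ℝ (Submodule.span ℝ (Set.range u)) = 3)
    {A : Matrix (Fin n) (Fin n) ℝ} (hA : A ∈ copositiveFace u) : A.PosSemidef := by
  obtain ⟨hcop, hzero⟩ := hA
  have hsymm : Aᵀ = A := hcop.1
  have hc := isCompl_leadingCoordinates hn hu_nonneg hu_supp h3
  let T : Matrix (Fin n) (Fin n) ℝ := LinearMap.toMatrix' (Submodule.projection _ _ hc)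
  have hT : ∀ x, T *ᵥ x = Submodule.projection _ _ hc x := LinearMap.toMatrix'_mulVec _
  have hTu : ∀ j, T *ᵥ u j = 0 := fun j => by
    rw [hT, Submodule.projection_apply_eq_zero_iff]
    exact Submodule.subset_span ⟨j, rfl⟩
  have hTe : ∀ k : Fin n, (k : ℕ) < n - 3 → T *ᵥ Pi.single k 1 = Pi.single k 1 := fun k hk => by
    rw [hT, Submodule.projection_eq_self_iff]
    intro i hi
    exact Pi.single_eq_of_ne (fun h => by rw [h] at hi; omega) _
  have hGsymm : (congruence T A)ᵀ = congruence T A := by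
    simp only [congruence_apply, Matrix.transpose_mul, Matrix.transpose_transpose, hsymm,
      Matrix.mul_assoc]
  -- The leading coordinates lie in the support of the first vector, where the form of `A` is
  -- positive semi-definite.
  have hG : (congruence T A).PosSemidef := by
    refine Matrix.PosSemidef.of_dotProduct_mulVec_nonneg hGsymm fun x => ?_
    rw [star_trivial, dotProduct_congruence_mulVec]
    refine (copositive_zero_support hcop (hu_nonneg ⟨0, by omega⟩) (hzero _) fun i hi => ?_).2
    rw [eq_zero_iff_notMem_cyclicSupport hu_nonneg hu_supp,
      mem_cyclicSupport_iff (by omega)] at hi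
    rw [hT]
    refine Submodule.projection_apply_mem hc x i ?_
    simp only at hi
    omega
  -- The two matrices agree on the leading block, whose basis vectors `T` fixes. On its support each
  -- `u j` is annihilated by `A` by the first order condition, and by the pullback because `T` kills
  -- `u j`.
  have hAG : A - congruence T A = 0 := by
    refine eq_zero_of_mulVec_cyclicSupport hn hu_nonneg hu_supp ?_ ?_ ?_
    · rw [Matrix.IsSymm, Matrix.transpose_sub, hGsymm, hsymm]
    · intro j i hi
      have h1 := (copositive_zero_support (x := Pi.single i 1) hcop (hu_nonneg j) (hzero j)
        fun k hk => Pi.single_eq_of_ne (by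
          rintro rfl
          exact (eq_zero_iff_notMem_cyclicSupport hu_nonneg hu_supp).1 hk hi) _).1
      rw [single_one_dotProduct] at h1
      rw [Matrix.sub_mulVec, Pi.sub_apply, h1, congruence_apply, ← Matrix.mulVec_mulVec, hTu,
        Matrix.mulVec_zero, Pi.zero_apply, sub_zero]
    · intro k l hk hl
      have h1 := dotProduct_congruence_mulVec T A (Pi.single k 1) (Pi.single l 1)
      rw [hTe k hk, hTe l hl] at h1
      simp only [single_one_dotProduct, Matrix.mulVec_single_one, Matrix.col_apply] at h1
      rw [Matrix.sub_apply, h1, sub_self]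
  rw [sub_eq_zero.1 hAG]
  exact hG

theorem isSlackMatrix_of_finrank_eq_three (hn : 5 ≤ n) (hu_nonneg : ∀ j i, 0 ≤ u j i)
    (hu_supp : ∀ j, {i | 0 < u j i} = cyclicSupport n j)
    (h3 : Module.finrank ℝ (Submodule.span ℝ (Set.range u)) = 3) :
    ∃ K : PointedCone ℝ (Fin 3 → ℝ), IsPolyhedralCone K ∧ (extremeRays K).ncard = n ∧
      IsSlackMatrix K (Matrix.of fun i j => u j i) := by
  have : NeZero n := ⟨by omega⟩
  let L := Submodule.span ℝ (Set.range u)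
  let e : L ≃ₗ[ℝ] (Fin 3 → ℝ) := LinearEquiv.ofFinrankEq _ _ (by rw [h3]; simp)
  let f : Fin n → Module.Dual ℝ (Fin 3 → ℝ) := fun i =>
    LinearMap.proj i ∘ₗ L.subtype ∘ₗ e.symm.toLinearMap
  let x : Fin n → Fin 3 → ℝ := fun j => e ⟨u j, Submodule.subset_span ⟨j, rfl⟩⟩
  have hfx : ∀ i j, f i (x j) = u j i := fun i j => by simp [f, x]
  have hval : ∀ i : Fin n, i + 1 ≠ i ∧ i + 1 + 1 ≠ i := by
    intro i
    have h1 := val_add_one_eq (by omega) i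
    have h2 := val_add_one_eq (by omega) (i + 1)
    rw [Ne, Ne, Fin.ext_iff, Fin.ext_iff, h2, h1]
    split_ifs <;> omega
  have := isSlackMatrix_of_cyclicPairing (f := f) (x := x) (by simp) (Equiv.addRight 1)
    (fun i => (hval i).1) (fun i => (hval i).2) (fun i j => by
      rw [hfx, eq_zero_iff_notMem_cyclicSupport hu_nonneg hu_supp,
        notMem_cyclicSupport_iff (by omega)]
      rfl) (fun i j => by rw [hfx]; exact hu_nonneg j i)
  simpa only [hfx] using this

/-- Every column is the image of some `x j` under the linear map with components `f i`, whose source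
has dimension 3. -/
theorem finrank_le_three_of_isSlackMatrix {K : PointedCone ℝ (Fin 3 → ℝ)}
    (h : IsSlackMatrix K (Matrix.of fun i j => u j i)) :
    Module.finrank ℝ (Submodule.span ℝ (Set.range u)) ≤ 3 := by
  obtain ⟨x, f, -, -, hfx⟩ := h
  have hle : Submodule.span ℝ (Set.range u) ≤ LinearMap.range (LinearMap.pi f) := by
    rw [Submodule.span_le]
    rintro _ ⟨j, rfl⟩
    exact ⟨x j, funext fun i => (hfx i j).symm⟩
  calc _ ≤ _ := Submodule.finrank_mono hle
    _ ≤ _ := LinearMap.finrank_range_le _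
    _ = 3 := by simp

end Faces

/-! ### The equivalences, each through the dimension of the span. -/

theorem mainTheorem8 (n : ℕ) (hn : 5 ≤ n) (u : Fin n → Fin n → ℝ)
    (hu_nonneg : ∀ j i, 0 ≤ u j i)
    (hu_supp : ∀ j, {i | 0 < u j i} = cyclicSupport n j) :
    (((∀ A ∈ copositiveFace u, A.PosSemidef) ∧
        Matrix.rank '' copositiveFace u = Set.Iic (n - 3)) ↔
      ∃ K : PointedCone ℝ (Fin 3 → ℝ), IsPolyhedralCone K ∧ (extremeRays K).ncard = n ∧
        IsSlackMatrix K (Matrix.of fun i j => u j i)) ∧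
    (((∀ A ∈ copositiveFace u, A.PosSemidef) ∧
        Matrix.rank '' copositiveFace u = Set.Iic (n - 3)) ↔
      (copositiveFace u = psdFace u ∧
        LinearlyIsomorphicCones (copositiveFace u) (psdCone (n - 3)))) := by
  have hle : Module.finrank ℝ (Submodule.span ℝ (Set.range u)) ≤ n := by
    simpa using Submodule.finrank_le (Submodule.span ℝ (Set.range u))
  obtain ⟨k, hk⟩ := Nat.exists_eq_add_of_le' hle
  replace hk := hk.symm
  have hrank : ((∀ A ∈ copositiveFace u, A.PosSemidef) ∧
      Matrix.rank '' copositiveFace u = Set.Iic (n - 3)) ↔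
      Module.finrank ℝ (Submodule.span ℝ (Set.range u)) = 3 := by
    constructor
    · rintro ⟨h1, h2⟩
      rw [copositiveFace_eq_psdFace_iff.2 h1, rank_image_psdFace u hk] at h2
      have := Set.Iic_injective h2
      omega
    · intro h3
      have h1 : ∀ A ∈ copositiveFace u, A.PosSemidef := fun A hA =>
        posSemidef_of_mem_copositiveFace hn hu_nonneg hu_supp h3 hA
      refine ⟨h1, ?_⟩
      rw [copositiveFace_eq_psdFace_iff.2 h1, rank_image_psdFace u hk]
      congr 1
      omega
  rw [hrank]
  refine ⟨⟨isSlackMatrix_of_finrank_eq_three hn hu_nonneg hu_supp, ?_⟩, ?_, ?_⟩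
  · rintro ⟨K, -, -, hK⟩
    exact le_antisymm (finrank_le_three_of_isSlackMatrix hK)
      (three_le_finrank_span hn hu_nonneg hu_supp)
  · intro h3
    have h1 := copositiveFace_eq_psdFace_iff.2 (hrank.2 h3).1
    obtain rfl : k = n - 3 := by omega
    exact ⟨h1, h1 ▸ linearlyIsomorphicCones_psdFace u hk⟩
  · rintro ⟨h1, h2⟩
    rw [h1] at h2
    have h3 := (linearlyIsomorphicCones_psdFace u hk).finrank_eq.symm.trans h2.finrank_eq
    have := strictMono_finrank_span_psdCone.injective h3
    omega
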